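/- **Setting.** An arm is a serial chain of $n_q$ links and single-axis revolute joints. For joint $i$ let $a_i$ be its unit axis and $R_i(\theta)=B_i\,\mathrm{Rot}(a_i,\theta)\in SO(3)$ the rotation of link $i$ relative to link $i-1$, where $B_i\in SO(3)$ is fixed and $\mathrm{Rot}(a,\theta)=aa^\top+\cos\theta\,(I-aa^\top)+\sin\theta\,[a]_\times$; let $l_i\in\mathbb R^3$ be the joint displacements and $\mathcal L_i\subset\mathbb R^3$ the link volumes. The forward occupancy of link $i$ in the configuration $q$ is $$\mathrm{FO}_i(q)=\Big\{\sum_{j<i}\Big(\prod_{n\le j}R_n(q_n)\Big)l_j\Big\}\oplus\Big(\prod_{n\le i}R_n(q_n)\Big)\mathcal L_i ,$$ with products ordered by increasing index and $\oplus$ the Minkowski sum of sets. Let $0<t_{\rm plan}<t_{\rm f}$ and $T=[0,t_{\rm f}]$. Parameters are $k=(k^v,k^a)\in K=\prod_iK_i$ with $K_i=[\bar k^v_i\pm\Delta k^v_i]\times[\bar k^a_i\pm\Delta k^a_i]$, $\Delta k^v_i>0$, $\Delta k^a_i\ge0$. The trajectory $q(t;k)$ has $q_i(0;k)=0$ and $\dot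 q_i(t;k)=k^v_i+k^a_it$ on $[0,t_{\rm plan})$, $\dot q_i(t;k)=\frac{k^v_i+k^a_it_{\rm plan}}{t_{\rm f}-t_{\rm plan}}(t_{\rm f}-t)$ on $[t_{\rm plan},t_{\rm f}]$. Partition $T$ into $N=t_{\rm f}/\Delta t$ closed intervals of length $\Delta t$. A zonotope with center $c$ and generators $g^1,\dots,g^p$ is $\{c+\sum_j\beta^jg^j: -1\le\beta^j\le1\}$ (a matrix zonotope if $c,g^j$ are matrices). For each joint $i$ and each of the $N$ intervals let a zonotope in $\mathbb R^4$ be given that contains $(\cos q_i(t;k),\sin q_i(t;k),k^v_i,k^a_i)$ for all $t$ in that interval and all $k\in K$ (an over-approximation of the joint reachable set on that interval), whose center has the $k^v,k^a$-entries $\bar k^v_i,\bar k^a_i$, and for which there are two distinct generators $g^v,g^a$ such that $g^v$ has $k^v$-entry $\Delta k^v_i$, $g^a$ has $k^a$-entry $\Delta k^a_i$, and every generator other than $g^v$ (respectively $g^a$) has $k^v$-entry (respectively $k^a$-entry) zero. Let $Z_i(t)$ be the zonotope of the interval number $\min(\lfloor t/\Delta t\rfloor,N-1)$ (counted from $0$),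 which contains $t$. Fix an initial condition $(\hat q,\hat{\dot q})$. Slice $Z_i(t)$ by setting the coefficient of $g^v$ to $(\hat{\dot q}_i-\bar k^v_i)/\Delta k^v_i$. Write the cosine and sine entries of the resulting center and of the remaining generators as $(c^0,s^0)$ and $(c^j,s^j)$. Then $M_i(t)$ is the matrix zonotope with center $R_i(\hat q_i)\big(a_ia_i^\top+c^0(I-a_ia_i^\top)+s^0[a_i]_\times\big)$ and generators $R_i(\hat q_i)\big(c^j(I-a_ia_i^\top)+s^j[a_i]_\times\big)$. Let $L_i\supseteq\mathcal L_i$ be zonotopes, let $MS=\{Az: A\in M,\ z\in S\}$ for a set of matrices $M$ and a set of vectors $S$, and define the rotatotope $$V_i(t)=\bigoplus_{j<i}\Big(\prod_{n\le j}M_n(t)\,\{l_j\}\Big)\oplus\Big(\prod_{n\le i}M_n(t)\,L_i\Big)\subset\mathbb R^3 .$$ **Lemma 5.** For every link $i$, every $t\in T$ and every $k\in K$ with $k^v_j=\hat{\dot q}_j$ for all $j\le i$, $$\mathrm{FO}_i\big(q(t;k)+\hat q\big)\subseteq V_i(t).$$ Consequently the rotatotopes over-approximate the reachable set of the arm. Let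 $\mathcal R_i$ be the set of all pairs $(Y,k)$ with $k\in K$ for which there is $t\in T$ such that $Y=\mathrm{FO}_i(q(t;k)+\hat q)$, $\dot q_j(0;k)=\hat{\dot q}_j$ for all $j\le i$, and $(\cos q_j(t;k),\sin q_j(t;k),k^v_j,k^a_j)$ lies in the joint reachable set of joint $j$ (the set of all $(\cos q_j(t';k'),\sin q_j(t';k'),k'^v_j,k'^a_j)$ with $t'\in T$, $k'\in K$) for all $j\le i$. Then $Y\subseteq\bigcup_{t\in T}V_i(t)$ for every $(Y,k)\in\mathcal R_i$, and $Y\subseteq\bigcup_{i}\bigcup_{t\in T}V_i(t)$ for every $(Y,k)\in\bigcup_i\mathcal R_i$. -/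

import Mathlib

namespace ARMTD

/-- Points and vectors of the three-dimensional workspace. -/
abbrev Vec3 : Type := Fin 3 → ℝ

/-- Real `3 × 3` matrices. -/
abbrev Mat3 : Type := Matrix (Fin 3) (Fin 3) ℝ

/-! ### Zonotopes and matrix zonotopes -/

/-- A zonotope in a real vector space `E`, given by its center and its generators; the generator
`gen i` carries its own indeterminate coefficient, which is named by the index `i : ι`.
A zonotope in `Mat3` is a matrix zonotope. -/
structure Zonotope (ι E : Type) where
  center : E
  gen : ι → E

/-- The set of points of a zonotope: all indeterminates range over `[-1, 1]`. -/
def Zonotope.toSet {ι E : Type} [Fintype ι] [AddCommGroup E] [Module ℝ E]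
    (Z : Zonotope ι E) : Set E :=
  {y | ∃ β : ι → ℝ, (∀ i, -1 ≤ β i ∧ β i ≤ 1) ∧ y = Z.center + ∑ i, β i • Z.gen i}

/-- Slicing: the indeterminate `v` is evaluated at `σ`, so that its (now fully sliced) generator
is added to the center and removed from the list of generators. -/
def Zonotope.slice {ι E : Type} [AddCommGroup E] [Module ℝ E]
    (Z : Zonotope ι E) (v : ι) (σ : ℝ) : Zonotope {i : ι // i ≠ v} E where
  center := Z.center + σ • Z.gen v
  gen := fun i => Z.gen i.1

/-- The product `M S = {A z | A ∈ M, z ∈ S}` of a set of matrices and a set of vectors.  For a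
matrix zonotope `M` and a zonotope (or rotatotope) `S` it is a rotatotope. -/
def matSetMul (M : Set Mat3) (S : Set Vec3) : Set Vec3 :=
  {y | ∃ A ∈ M, ∃ z ∈ S, y = A.mulVec z}

/-! ### The arm -/

/-- The matrix of `v ↦ a × v`. -/
def crossMat (a : Vec3) : Mat3 :=
  !![0, -(a 2), a 1;
     a 2, 0, -(a 0);
     -(a 1), a 0, 0]

/-- The matrix `c (I - a aᵀ) + s [a]ₓ`, linear in `(c, s)`. For the third coordinate axis
this is `[[c, -s, 0], [s, c, 0], [0, 0, 0]]`. -/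
def reshape (a : Vec3) (c s : ℝ) : Mat3 :=
  c • (1 - Matrix.vecMulVec a a) + s • crossMat a

/-- Rotation by the angle `θ` about the unit vector `a` (Rodrigues' formula). -/
noncomputable def axisRot (a : Vec3) (θ : ℝ) : Mat3 :=
  Matrix.vecMulVec a a + reshape a (Real.cos θ) (Real.sin θ)

/-- A serial arm with `n` single-axis revolute joints. Joint and link `1, …, n` of the usual
numbering are `0, …, n - 1` here; the baselink carries the global frame. -/
structure Arm (n : ℕ) where
  /-- the axis of each joint -/
  axis : Fin n → Vec3
  axis_unit : ∀ i, dotProduct (axis i) (axis i) = 1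
  /-- the orientation of link `i` relative to its predecessor at joint angle `0` -/
  mount : Fin n → Mat3
  mount_mem : ∀ i, mount i ∈ Matrix.specialOrthogonalGroup (Fin 3) ℝ
  /-- the joint displacements `l i` -/
  l : Fin n → Vec3
  /-- the volume occupied by each link, in its own frame -/
  link : Fin n → Set Vec3

/-- `R_i(θ)`: the rotation of link `i` relative to its predecessor. -/
noncomputable def Arm.R {n : ℕ} (A : Arm n) (i : Fin n) (θ : ℝ) : Mat3 :=
  A.mount i * axisRot (A.axis i) θ

/-- The joints `m ≤ j`, in increasing order. -/
def upTo {n : ℕ} (j : Fin n) : List (Fin n) :=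
  (List.finRange n).filter (fun m => m ≤ j)

/-- The ordered product `∏_{m ≤ j} R_m(q_m)`. -/
noncomputable def Arm.cumRot {n : ℕ} (A : Arm n) (q : Fin n → ℝ) (j : Fin n) : Mat3 :=
  ((upTo j).map (fun m => A.R m (q m))).prod

open scoped Pointwise in
/-- The forward occupancy of link `i` in the configuration `q`. -/
noncomputable def Arm.FO {n : ℕ} (A : Arm n) (i : Fin n) (q : Fin n → ℝ) : Set Vec3 :=
  {∑ j ∈ Finset.Iio i, (A.cumRot q j).mulVec (A.l j)}
    + (fun v => (A.cumRot q i).mulVec v) '' A.link i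

/-! ### Parameterized trajectories -/

/-- Trajectory parameters `k = (kᵛ, kᵃ)`: initial velocities and accelerations of the joints. -/
structure Param (n : ℕ) where
  vel : Fin n → ℝ
  acc : Fin n → ℝ

/-- The timing, the parameter intervals `kvMid ± kvRad` and `kaMid ± kaRad` of each joint, and
the partition of `[0, tfin]` into `N` intervals of length `dt`. -/
structure Planner (n : ℕ) where
  tplan : ℝ
  tfin : ℝ
  tplan_pos : 0 < tplan
  tplan_lt : tplan < tfin
  kvMid : Fin n → ℝ
  kvRad : Fin n → ℝ
  kaMid : Fin n → ℝ
  kaRad : Fin n → ℝ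
  kvRad_pos : ∀ i, 0 < kvRad i
  kaRad_nonneg : ∀ i, 0 ≤ kaRad i
  dt : ℝ
  N : ℕ
  dt_pos : 0 < dt
  N_mul_dt : (N : ℝ) * dt = tfin

namespace Planner

variable {n : ℕ}

/-- The time horizon `T = [0, tfin]`. -/
def T (P : Planner n) : Set ℝ := Set.Icc 0 P.tfin

/-- The parameters of joint `i`: the rectangle `Kᵛ_i × Kᵃ_i`. -/
def Kjoint (P : Planner n) (i : Fin n) : Set (ℝ × ℝ) :=
  Set.Icc (P.kvMid i - P.kvRad i) (P.kvMid i + P.kvRad i)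
    ×ˢ Set.Icc (P.kaMid i - P.kaRad i) (P.kaMid i + P.kaRad i)

/-- The parameter space `K`. -/
def K (P : Planner n) : Set (Param n) := {k | ∀ i, (k.vel i, k.acc i) ∈ P.Kjoint i}

/-- The velocity at time `t` of a joint with initial velocity `kv` and acceleration `ka`: constant
acceleration until `tplan`, then braking to a stop at `tfin` with constant deceleration. -/
noncomputable def jointVel (P : Planner n) (kv ka t : ℝ) : ℝ :=
  if t < P.tplan then kv + ka * t
  else (kv + ka * P.tplan) / (P.tfin - P.tplan) * (P.tfin - t)

/-- The angle of a joint at time `t`, starting from angle `0`. -/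
noncomputable def jointAngle (P : Planner n) (kv ka t : ℝ) : ℝ :=
  ∫ τ in (0 : ℝ)..t, P.jointVel kv ka τ

/-- The joint trajectory `q(t; k)`. -/
noncomputable def q (P : Planner n) (t : ℝ) (k : Param n) : Fin n → ℝ :=
  fun i => P.jointAngle (k.vel i) (k.acc i) t

/-- The joint velocity `q̇(t; k)`. -/
noncomputable def qdot (P : Planner n) (t : ℝ) (k : Param n) : Fin n → ℝ :=
  fun i => P.jointVel (k.vel i) (k.acc i) t

/-! ### Joint reachable sets -/

/-- All `(cos q_i(t; k), sin q_i(t; k), kᵛ_i, kᵃ_i)` reached by joint `i` at times `t ∈ I`. -/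
def jrsOn (P : Planner n) (i : Fin n) (I : Set ℝ) : Set (Fin 4 → ℝ) :=
  {x | ∃ t ∈ I, ∃ κ ∈ P.Kjoint i,
    x = ![Real.cos (P.jointAngle κ.1 κ.2 t), Real.sin (P.jointAngle κ.1 κ.2 t), κ.1, κ.2]}

/-- The parameterized joint reachable set (JRS) of joint `i`. -/
def jrs (P : Planner n) (i : Fin n) : Set (Fin 4 → ℝ) := P.jrsOn i P.T

end Planner

/-- A zonotope with `p` generators in the `(cos, sin, kᵛ, kᵃ)`-space of one joint, with the indices
of its `kᵛ`-sliceable and `kᵃ`-sliceable generators. -/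
structure JRSZonotope where
  p : ℕ
  zono : Zonotope (Fin p) (Fin 4 → ℝ)
  iv : Fin p
  ia : Fin p

/-- `J i m`, for `m < N`, is a zonotope representation of the JRS of joint `i` over the `m`-th time
interval `[m dt, (m + 1) dt]`: it encloses everything that joint `i` reaches in that
interval, and only one generator has a nonzero `kᵛ`-entry, equal to `kvRad`, and only one, a
different one, has a nonzero `kᵃ`-entry, equal to `kaRad`. -/
structure Planner.IsJRS {n : ℕ} (P : Planner n) (J : Fin n → ℕ → JRSZonotope) : Prop where
  encloses : ∀ i, ∀ m < P.N,
    P.jrsOn i (Set.Icc ((m : ℝ) * P.dt) (((m : ℝ) + 1) * P.dt)) ⊆ (J i m).zono.toSet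
  iv_ne_ia : ∀ i, ∀ m < P.N, (J i m).iv ≠ (J i m).ia
  center_vel : ∀ i, ∀ m < P.N, (J i m).zono.center 2 = P.kvMid i
  center_acc : ∀ i, ∀ m < P.N, (J i m).zono.center 3 = P.kaMid i
  gen_vel : ∀ i, ∀ m < P.N, (J i m).zono.gen (J i m).iv 2 = P.kvRad i
  gen_acc : ∀ i, ∀ m < P.N, (J i m).zono.gen (J i m).ia 3 = P.kaRad i
  gen_vel_eq_zero : ∀ i, ∀ m < P.N, ∀ j, j ≠ (J i m).iv → (J i m).zono.gen j 2 = 0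
  gen_acc_eq_zero : ∀ i, ∀ m < P.N, ∀ j, j ≠ (J i m).ia → (J i m).zono.gen j 3 = 0

/-- Such representations exist for every choice of the timing and of the parameter intervals. -/
theorem Planner.exists_isJRS {n : ℕ} (P : Planner n) : ∃ J, P.IsJRS J := by
  refine ⟨fun i _ =>
    { p := 4
      zono :=
        { center := ![0, 0, P.kvMid i, P.kaMid i]
          gen := ![![1, 0, 0, 0], ![0, 1, 0, 0], ![0, 0, P.kvRad i, 0], ![0, 0, 0, P.kaRad i]] }
      iv := 2
      ia := 3 }, ?_⟩
  constructor
  case encloses =>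
    rintro i m - x ⟨t, -, κ, ⟨⟨h1, h2⟩, h3, h4⟩, rfl⟩
    have hv := P.kvRad_pos i
    obtain ⟨b, hb1, hb2, hb⟩ : ∃ b : ℝ, -1 ≤ b ∧ b ≤ 1 ∧ κ.2 = P.kaMid i + b * P.kaRad i := by
      rcases (P.kaRad_nonneg i).eq_or_lt with h | h
      · exact ⟨0, by norm_num, by norm_num, by rw [← h] at h3 h4; linarith⟩
      · refine ⟨(κ.2 - P.kaMid i) / P.kaRad i, ?_, ?_, ?_⟩
        · rw [le_div_iff₀ h]; linarith
        · rw [div_le_iff₀ h]; linarith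
        · field_simp; ring
    refine ⟨![Real.cos (P.jointAngle κ.1 κ.2 t), Real.sin (P.jointAngle κ.1 κ.2 t),
      (κ.1 - P.kvMid i) / P.kvRad i, b], ?_, ?_⟩
    · intro j
      fin_cases j
      · exact ⟨Real.neg_one_le_cos _, Real.cos_le_one _⟩
      · exact ⟨Real.neg_one_le_sin _, Real.sin_le_one _⟩
      · exact ⟨by simp; rw [le_div_iff₀ hv]; linarith, by simp; rw [div_le_iff₀ hv]; linarith⟩
      · exact ⟨hb1, hb2⟩
    · funext j
      fin_cases j
      · simp [Fin.sum_univ_four]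
      · simp [Fin.sum_univ_four]
      · simp [Fin.sum_univ_four]; field_simp; ring
      · simp [Fin.sum_univ_four, hb]
  all_goals
    intro i m hm
    try intro j
    try fin_cases j
    all_goals (try intro hne)
    all_goals simp_all

/-- The number of the subinterval that contains `t`; the endpoint `tfin` belongs to the last
one, whose number is `N - 1`. -/
noncomputable def Planner.timeIdx {n : ℕ} (P : Planner n) (t : ℝ) : ℕ :=
  min ⌊t / P.dt⌋₊ (P.N - 1)

/-! ### Rotatotopes -/

/-- The matrix zonotope obtained by reshaping the `(cos, sin)`-part of the center and of the
generators of `Z`, keeping the indeterminates, and rotating by the initial joint angle `θ₀`. -/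
noncomputable def Arm.makeMatZono {n : ℕ} (A : Arm n) (i : Fin n) (θ₀ : ℝ) {ι : Type}
    (Z : Zonotope ι (Fin 4 → ℝ)) : Zonotope ι Mat3 where
  center := A.R i θ₀ * (Matrix.vecMulVec (A.axis i) (A.axis i)
    + reshape (A.axis i) (Z.center 0) (Z.center 1))
  gen := fun j => A.R i θ₀ * reshape (A.axis i) (Z.gen j 0) (Z.gen j 1)

section Online

variable {n : ℕ} (A : Arm n) (P : Planner n) (J : Fin n → ℕ → JRSZonotope)
  (q₀ dq₀ : Fin n → ℝ)

/-- `Z_i(t)` sliced by the initial velocity of joint `i`. -/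
noncomputable def slicedJRS (i : Fin n) (t : ℝ) :
    Zonotope {j : Fin (J i (P.timeIdx t)).p // j ≠ (J i (P.timeIdx t)).iv} (Fin 4 → ℝ) :=
  (J i (P.timeIdx t)).zono.slice (J i (P.timeIdx t)).iv ((dq₀ i - P.kvMid i) / P.kvRad i)

/-- The matrix zonotope `M_i(t)`. -/
noncomputable def matZono (i : Fin n) (t : ℝ) :
    Zonotope {j : Fin (J i (P.timeIdx t)).p // j ≠ (J i (P.timeIdx t)).iv} Mat3 :=
  A.makeMatZono i (q₀ i) (slicedJRS P J dq₀ i t)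

/-- The rotatotope `∏_{m ≤ j} M_m(t) S = M_1(t) (M_2(t) (⋯ (M_j(t) S)))`. -/
noncomputable def chain (t : ℝ) (j : Fin n) (S : Set Vec3) : Set Vec3 :=
  (upTo j).foldr (fun m S' => matSetMul (matZono A P J q₀ dq₀ m t).toSet S') S

open scoped Pointwise in
/-- The stacked rotatotope `V_i(t)`, where the zonotope `L i` represents the volume of link `i`;
sums of sets are Minkowski sums. -/
noncomputable def V {pL : Fin n → ℕ} (L : (i : Fin n) → Zonotope (Fin (pL i)) Vec3)
    (i : Fin n) (t : ℝ) : Set Vec3 :=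
  (∑ j ∈ Finset.Iio i, chain A P J q₀ dq₀ t j {A.l j}) + chain A P J q₀ dq₀ t i (L i).toSet

/-- The reachable set of link `i` for the initial condition `(q₀, dq₀)`: the pairs of a volume
occupied by link `i` at some time and the trajectory parameter that causes it. -/
def linkRS (i : Fin n) : Set (Set Vec3 × Param n) :=
  {Yk | Yk.2 ∈ P.K ∧ ∃ t ∈ P.T,
    (∀ j ≤ i, P.qdot 0 Yk.2 j = dq₀ j) ∧
    Yk.1 = A.FO i (P.q t Yk.2 + q₀) ∧
    ∀ j ≤ i, ![Real.cos (P.q t Yk.2 j), Real.sin (P.q t Yk.2 j), Yk.2.vel j, Yk.2.acc j] ∈ P.jrs j}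

/-- The reachable set of the whole arm. -/
def armRS : Set (Set Vec3 × Param n) := ⋃ i, linkRS A P q₀ dq₀ i

end Online

end ARMTD

/-!
Fix a time `t`, and let `q` be the joint angles at time `t`. Over the subinterval containing `t`,
the JRS zonotope of joint `i` contains the point `(cos qᵢ, sin qᵢ, kᵛᵢ, kᵃᵢ)` for some choice of
coefficients. Since a single generator has a nonzero `kᵛ`-entry, the `kᵛ`-coordinate of the point
determines the coefficient of that generator; when `kᵛᵢ` is the initial velocity, it is the value
at which the zonotope is sliced, so the remaining coefficients exhibit the point in the slice
(`slicedJRS_mem`). Reshaping is linear in `(cos, sin)` and rotations about a common axis compose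
by adding angles, so the same coefficients exhibit the rotation matrix `Rᵢ(qᵢ + q̂ᵢ)` in the matrix
zonotope `Mᵢ(t)` (`R_mem_matZono`). Products of matrices and vectors then lie in the
corresponding set products (`cumRot_mulVec_mem_chain`), and so do their sums in the Minkowski sum.
The statements on the reachable sets follow because the velocity at time `0` is `kᵛ`.
-/

namespace ARMTD

/-! ### Rotations about a fixed axis -/

theorem reshape_add (a : Vec3) (c s c' s' : ℝ) :
    reshape a (c + c') (s + s') = reshape a c s + reshape a c' s' := by
  simp only [reshape, add_smul]; abel

theorem reshape_smul (a : Vec3) (b c s : ℝ) :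
    reshape a (b * c) (b * s) = b • reshape a c s := by
  simp only [reshape, mul_smul, smul_add]

theorem reshape_zero (a : Vec3) : reshape a 0 0 = 0 := by
  simp [reshape]

theorem reshape_sum {ι : Type*} (a : Vec3) (s : Finset ι) (β c d : ι → ℝ) :
    reshape a (∑ j ∈ s, β j * c j) (∑ j ∈ s, β j * d j) = ∑ j ∈ s, β j • reshape a (c j) (d j) := by
  classical
  induction s using Finset.induction_on with
  | empty => simp [reshape_zero]
  | insert i s hi ih => simp only [Finset.sum_insert hi, reshape_add, reshape_smul, ih]

theorem vecMulVec_self_mul_self {a : Vec3} (ha : dotProduct a a = 1) :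
    Matrix.vecMulVec a a * Matrix.vecMulVec a a = Matrix.vecMulVec a a := by
  rw [Matrix.vecMulVec_mul_vecMulVec, ha, one_smul]

theorem vecMulVec_mul_crossMat (a : Vec3) : Matrix.vecMulVec a a * crossMat a = 0 := by
  ext i j
  fin_cases j <;>
    simp [Matrix.mul_apply, Fin.sum_univ_three, Matrix.vecMulVec_apply, crossMat] <;> ring

theorem crossMat_mul_vecMulVec (a : Vec3) : crossMat a * Matrix.vecMulVec a a = 0 := by
  ext i j
  fin_cases i <;>
    simp [Matrix.mul_apply, Fin.sum_univ_three, Matrix.vecMulVec_apply, crossMat] <;> ring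

theorem crossMat_mul_self {a : Vec3} (ha : dotProduct a a = 1) :
    crossMat a * crossMat a = Matrix.vecMulVec a a - 1 := by
  have h : a 0 * a 0 + a 1 * a 1 + a 2 * a 2 = 1 := by
    simpa [dotProduct, Fin.sum_univ_three] using ha
  ext i j
  fin_cases i <;> fin_cases j <;>
    simp [Matrix.mul_apply, Fin.sum_univ_three, Matrix.vecMulVec_apply, crossMat] <;> linarith

theorem axisRot_mul_axisRot {a : Vec3} (ha : dotProduct a a = 1) (θ φ : ℝ) :
    axisRot a θ * axisRot a φ = axisRot a (θ + φ) := by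
  simp only [axisRot, reshape, Real.cos_add, Real.sin_add, mul_add, add_mul, mul_sub, sub_mul,
    smul_mul_assoc, mul_smul_comm, vecMulVec_self_mul_self ha, vecMulVec_mul_crossMat,
    crossMat_mul_vecMulVec, crossMat_mul_self ha, one_mul, mul_one]
  module

theorem Arm.R_add {n : ℕ} (A : Arm n) (i : Fin n) (θ φ : ℝ) :
    A.R i (θ + φ) = A.R i θ * axisRot (A.axis i) φ := by
  rw [Arm.R, Arm.R, mul_assoc, axisRot_mul_axisRot (A.axis_unit i)]

/-! ### Slicing and the matrix zonotopes -/

/-- A point whose coefficient along the sliced generator can be read off from its `d`-th coordinate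
lies in the slice at that coefficient. -/
theorem Zonotope.mem_slice {ι δ : Type} [Fintype ι] [DecidableEq ι] {Z : Zonotope ι (δ → ℝ)}
    {x : δ → ℝ} (hx : x ∈ Z.toSet) {v : ι} {d : δ} (hv : Z.gen v d ≠ 0)
    (h0 : ∀ j, j ≠ v → Z.gen j d = 0) :
    x ∈ (Z.slice v ((x d - Z.center d) / Z.gen v d)).toSet := by
  obtain ⟨β, hβ, rfl⟩ := hx
  have hσ : ((Z.center + ∑ i, β i • Z.gen i) d - Z.center d) / Z.gen v d = β v := by
    have : ∑ i, β i * Z.gen i d = β v * Z.gen v d :=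
      Finset.sum_eq_single v (fun j _ hj => by rw [h0 j hj, mul_zero]) (by simp)
    simp [Finset.sum_apply, this, hv]
  rw [hσ]
  refine ⟨fun j => β j.1, fun j => hβ j.1, ?_⟩
  simp only [Zonotope.slice]
  rw [add_assoc, ← Fintype.sum_eq_add_sum_subtype_ne (fun i => β i • Z.gen i) v]

theorem Arm.mem_makeMatZono {n : ℕ} (A : Arm n) (i : Fin n) (θ₀ : ℝ) {ι : Type} [Fintype ι]
    {Z : Zonotope ι (Fin 4 → ℝ)} {x : Fin 4 → ℝ} (hx : x ∈ Z.toSet) :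
    A.R i θ₀ * (Matrix.vecMulVec (A.axis i) (A.axis i) + reshape (A.axis i) (x 0) (x 1))
      ∈ (A.makeMatZono i θ₀ Z).toSet := by
  obtain ⟨β, hβ, rfl⟩ := hx
  refine ⟨β, hβ, ?_⟩
  simp only [Arm.makeMatZono, Pi.add_apply, Finset.sum_apply, Pi.smul_apply, smul_eq_mul,
    reshape_add, reshape_sum, mul_add, Finset.mul_sum, mul_smul_comm, add_assoc]

namespace Planner

variable {n : ℕ} (P : Planner n)

theorem N_pos : 0 < P.N := by
  rcases Nat.eq_zero_or_pos P.N with h | h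
  · have h1 := P.N_mul_dt
    have h2 := P.tplan_pos.trans P.tplan_lt
    rw [h] at h1
    simp at h1
    linarith
  · exact h

theorem timeIdx_lt (t : ℝ) : P.timeIdx t < P.N := by
  have := P.N_pos
  unfold timeIdx
  omega

theorem mem_Icc_timeIdx {t : ℝ} (ht : t ∈ P.T) :
    t ∈ Set.Icc ((P.timeIdx t : ℝ) * P.dt) (((P.timeIdx t : ℝ) + 1) * P.dt) := by
  have hdt := P.dt_pos
  have h0 : 0 ≤ t / P.dt := div_nonneg ht.1 hdt.le
  constructor
  · rw [← le_div_iff₀ hdt]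
    exact (Nat.cast_le.2 (min_le_left _ _)).trans (Nat.floor_le h0)
  · rw [← div_le_iff₀ hdt]
    rcases le_total ⌊t / P.dt⌋₊ (P.N - 1) with h | h
    · rw [timeIdx, min_eq_left h]
      exact (Nat.lt_floor_add_one _).le
    · -- This case includes the endpoint `tfin`, whose floor is `N`.
      rw [timeIdx, min_eq_right h, Nat.cast_pred P.N_pos, sub_add_cancel, div_le_iff₀ hdt,
        P.N_mul_dt]
      exact ht.2

theorem qdot_zero (k : Param n) : P.qdot 0 k = k.vel := by
  funext i
  simp [qdot, jointVel, P.tplan_pos]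

end Planner

section Online

variable {n : ℕ} (A : Arm n) (P : Planner n) {J : Fin n → ℕ → JRSZonotope}
  (q₀ : Fin n → ℝ) {dq₀ : Fin n → ℝ} {t : ℝ} {k : Param n}

theorem slicedJRS_mem (hJ : P.IsJRS J) (ht : t ∈ P.T) (hk : k ∈ P.K) {i : Fin n}
    (hv : k.vel i = dq₀ i) :
    ![Real.cos (P.q t k i), Real.sin (P.q t k i), k.vel i, k.acc i]
      ∈ (slicedJRS P J dq₀ i t).toSet := by
  have hm := P.timeIdx_lt t
  have hmem := hJ.encloses i _ hm ⟨t, P.mem_Icc_timeIdx ht, _, hk i, rfl⟩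
  have hgen : (J i (P.timeIdx t)).zono.gen (J i (P.timeIdx t)).iv 2 ≠ 0 := by
    rw [hJ.gen_vel i _ hm]
    exact (P.kvRad_pos i).ne'
  have := Zonotope.mem_slice hmem hgen (hJ.gen_vel_eq_zero i _ hm)
  rw [hJ.gen_vel i _ hm, hJ.center_vel i _ hm] at this
  rw [slicedJRS, ← hv]
  exact this

theorem R_mem_matZono (hJ : P.IsJRS J) (ht : t ∈ P.T) (hk : k ∈ P.K) {i : Fin n}
    (hv : k.vel i = dq₀ i) :
    A.R i ((P.q t k + q₀) i) ∈ (matZono A P J q₀ dq₀ i t).toSet := by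
  have h := A.mem_makeMatZono i (q₀ i) (slicedJRS_mem P hJ ht hk hv)
  simp only [Matrix.cons_val_zero, Matrix.cons_val_one] at h
  rwa [Pi.add_apply, add_comm, Arm.R_add, axisRot]

theorem prod_mulVec_mem_foldr {ι : Type*} {M : ι → Set Mat3} {R : ι → Mat3} {S : Set Vec3}
    {z : Vec3} (hz : z ∈ S) (l : List ι) (h : ∀ m ∈ l, R m ∈ M m) :
    (l.map R).prod.mulVec z ∈ l.foldr (fun m S' => matSetMul (M m) S') S := by
  induction l with
  | nil => simpa using hz
  | cons m l ih =>
    refine ⟨R m, h m (by simp), _, ih fun m' hm' => h m' (by simp [hm']), ?_⟩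
    simp [Matrix.mulVec_mulVec]

theorem cumRot_mulVec_mem_chain (hJ : P.IsJRS J) (ht : t ∈ P.T) (hk : k ∈ P.K) {i : Fin n}
    (hv : ∀ j ≤ i, k.vel j = dq₀ j) {z : Vec3} {S : Set Vec3} (hz : z ∈ S) :
    (A.cumRot (P.q t k + q₀) i).mulVec z ∈ chain A P J q₀ dq₀ t i S := by
  refine prod_mulVec_mem_foldr hz (upTo i) fun m hm => ?_
  exact R_mem_matZono A P q₀ hJ ht hk (hv m (by simpa [upTo] using hm))

theorem FO_subset_V (hJ : P.IsJRS J) {pL : Fin n → ℕ}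
    {L : (i : Fin n) → Zonotope (Fin (pL i)) Vec3} {i : Fin n} (hL : A.link i ⊆ (L i).toSet)
    (ht : t ∈ P.T) (hk : k ∈ P.K) (hv : ∀ j ≤ i, k.vel j = dq₀ j) :
    A.FO i (P.q t k + q₀) ⊆ V A P J q₀ dq₀ L i t := by
  refine Set.add_subset_add ?_ ?_
  · rw [Set.singleton_subset_iff]
    refine Set.finsetSum_mem_finsetSum _ _ _ fun j hj => ?_
    have hji : j ≤ i := (Finset.mem_Iio.1 hj).le
    exact cumRot_mulVec_mem_chain A P q₀ hJ ht hk (fun m hm => hv m (hm.trans hji)) rfl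
  · rintro _ ⟨z, hz, rfl⟩
    exact cumRot_mulVec_mem_chain A P q₀ hJ ht hk hv (hL hz)

theorem linkRS_subset_iUnion_V (hJ : P.IsJRS J) {pL : Fin n → ℕ}
    {L : (i : Fin n) → Zonotope (Fin (pL i)) Vec3} {i : Fin n} (hL : A.link i ⊆ (L i).toSet)
    {Y : Set Vec3} (hY : (Y, k) ∈ linkRS A P q₀ dq₀ i) :
    Y ⊆ ⋃ t ∈ P.T, V A P J q₀ dq₀ L i t := by
  obtain ⟨hk, t, ht, hv, hFO, -⟩ := hY
  dsimp only at hk hv hFO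
  rw [P.qdot_zero] at hv
  rw [hFO]
  exact (FO_subset_V A P q₀ hJ hL ht hk hv).trans
    (Set.subset_biUnion_of_mem (u := fun t => V A P J q₀ dq₀ L i t) ht)

end Online

end ARMTD

theorem lemma5 {n : ℕ} (A : ARMTD.Arm n) (P : ARMTD.Planner n)
    (J : Fin n → ℕ → ARMTD.JRSZonotope) (hJ : P.IsJRS J)
    {pL : Fin n → ℕ} (L : (i : Fin n) → ARMTD.Zonotope (Fin (pL i)) ARMTD.Vec3)
    (hL : ∀ i, A.link i ⊆ (L i).toSet)
    (q₀ dq₀ : Fin n → ℝ) :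
    (∀ i : Fin n, ∀ t ∈ P.T, ∀ k ∈ P.K, (∀ j ≤ i, k.vel j = dq₀ j) →
      A.FO i (P.q t k + q₀) ⊆ ARMTD.V A P J q₀ dq₀ L i t) ∧
    (∀ i : Fin n, ∀ Y k, (Y, k) ∈ ARMTD.linkRS A P q₀ dq₀ i →
      Y ⊆ ⋃ t ∈ P.T, ARMTD.V A P J q₀ dq₀ L i t) ∧
    (∀ Y k, (Y, k) ∈ ARMTD.armRS A P q₀ dq₀ →
      Y ⊆ ⋃ i : Fin n, ⋃ t ∈ P.T, ARMTD.V A P J q₀ dq₀ L i t) := by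
  refine ⟨fun i t ht k hk hv => ARMTD.FO_subset_V A P q₀ hJ (hL i) ht hk hv,
    fun i Y k hY => ARMTD.linkRS_subset_iUnion_V A P q₀ hJ (hL i) hY, fun Y k hY => ?_⟩
  obtain ⟨i, hi⟩ := Set.mem_iUnion.1 hY
  exact (ARMTD.linkRS_subset_iUnion_V A P q₀ hJ (hL i) hi).trans
    (Set.subset_iUnion (fun i => ⋃ t ∈ P.T, ARMTD.V A P J q₀ dq₀ L i t) i)
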